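/- Let $n\ge 0$, let $D_+=\{x\in\mathbb R^n : x_1\ge x_2\ge\dots\ge x_n\ge 0\}$ and $\mathbb R^n_+=\{x\in\mathbb R^n : x_i\ge 0 \text{ for all } i\}$, both with Lebesgue measure. For $\lambda,x\in\mathbb R^n$ put $$\sin^{-}_\lambda(x)=\det(\sin 2\pi\lambda_ix_j)_{i,j=1}^n,\quad \sin^{+}_\lambda(x)={\det}^{+}(\sin 2\pi\lambda_ix_j)_{i,j=1}^n,$$ $$\cos^{-}_\lambda(x)=\det(\cos 2\pi\lambda_ix_j)_{i,j=1}^n,\quad \cos^{+}_\lambda(x)={\det}^{+}(\cos 2\pi\lambda_ix_j)_{i,j=1}^n,$$ where $\det^+(a_{ij})=\sum_{w\in S_n}a_{1,w(1)}\cdots a_{n,w(n)}$. Let $K_\lambda(x)$ be any one of these four functions, let $t$ be $\sin$ or $\cos$ accordingly, and put $\chi(w)=\det w$ (the sign of $w\in S_n$) in the two cases "$-$" and $\chi(w)=1$ in the two cases "$+$". With $(wx)_i=x_{w(i)}$, call $f:\mathbb R^n_+\to\mathbb C$ *$\chi$-symmetric* if $f(wx)=\chi(w)f(x)$ for all $w\in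 S_n$, $x\in\mathbb R^n_+$ (antisymmetric in the cases "$-$", symmetric in the cases "$+$"). For $f\in L^1(D_+)$ put $$\tilde f(\lambda)=\int_{D_+}f(x)\,K_\lambda(x)\,dx .$$ 1. If $f$ is $\chi$-symmetric and integrable on $D_+$, then $f$ is integrable on $\mathbb R^n_+$, and for all $\lambda\in\mathbb R^n$ and $w\in S_n$ $$\tilde f(\lambda)=\frac1{n!}\int_{\mathbb R^n_+}f(x)K_\lambda(x)\,dx=\int_{\mathbb R^n_+}f(x)\prod_{i=1}^n t(2\pi\lambda_ix_i)\,dx,\qquad \tilde f(w\lambda)=\chi(w)\tilde f(\lambda).$$ 2. (Inversion.) If $f:D_+\to\mathbb C$ and $\tilde f$ are integrable on $D_+$, then $$f(x)=2^{2n}\int_{D_+}\tilde f(\lambda)\,K_\lambda(x)\,d\lambda$$ for almost every $x\in D_+$, and for every $x\in D_+$ at which $f$, as a function on $D_+$, is continuous. If moreover $f$ is given on $\mathbb R^n_+$ and is $\chi$-symmetric, then the formula holds for almost every $x\in\mathbb R^n_+$, and for every $x\in\mathbb R^n_+$ at which $f$, as a function on $\mathbb R^n_+$, is continuous. 3. (Plancherel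 formula.) If $f\in L^1(D_+)\cap L^2(D_+)$, then $\tilde f\in L^2(D_+)$ and $$\int_{D_+}|f(x)|^2dx=2^{2n}\int_{D_+}|\tilde f(\lambda)|^2d\lambda .$$ 4. ($L^2$ theory.) There are bounded linear operators $T,S$ on $L^2(D_+)$ such that, for every $g\in L^1(D_+)\cap L^2(D_+)$, $Tg=\tilde g$ and $(Sg)(x)=2^{2n}\int_{D_+}g(\lambda)K_\lambda(x)\,d\lambda$ almost everywhere; they are inverse to each other, $STg=TSg=g$ for all $g\in L^2(D_+)$, and $\int_{D_+}|g|^2=2^{2n}\int_{D_+}|Tg|^2$ for all $g\in L^2(D_+)$. -/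

import Mathlib

noncomputable section

namespace MultiTrig

open MeasureTheory

/-- `sin⁻_lam(x) = det (sin 2π lam_i x_j)`. -/
def sinMinus {n : ℕ} (lam x : Fin n → ℝ) : ℝ :=
  (Matrix.of fun i j => Real.sin (2 * Real.pi * lam i * x j)).det

/-- `sin⁺_lam(x) = det⁺ (sin 2π lam_i x_j)`, where `det⁺` is the antideterminant (the determinant
with all signs replaced by `+`), that is, the permanent. -/
def sinPlus {n : ℕ} (lam x : Fin n → ℝ) : ℝ :=
  (Matrix.of fun i j => Real.sin (2 * Real.pi * lam i * x j)).permanent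

/-- `cos⁻_lam(x) = det (cos 2π lam_i x_j)`. -/
def cosMinus {n : ℕ} (lam x : Fin n → ℝ) : ℝ :=
  (Matrix.of fun i j => Real.cos (2 * Real.pi * lam i * x j)).det

/-- `cos⁺_lam(x) = det⁺ (cos 2π lam_i x_j)`. -/
def cosPlus {n : ℕ} (lam x : Fin n → ℝ) : ℝ :=
  (Matrix.of fun i j => Real.cos (2 * Real.pi * lam i * x j)).permanent

/-- The four types of (anti)symmetric multivariate trigonometric functions. -/
inductive Kind : Type
  | sinMinus
  | sinPlus
  | cosMinus
  | cosPlus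

/-- The multivariate trigonometric function of each type. -/
def Kind.kernel {n : ℕ} : Kind → (Fin n → ℝ) → (Fin n → ℝ) → ℝ
  | .sinMinus => MultiTrig.sinMinus
  | .sinPlus => MultiTrig.sinPlus
  | .cosMinus => MultiTrig.cosMinus
  | .cosPlus => MultiTrig.cosPlus

/-- The one-variable trigonometric function from which each type is built. -/
def Kind.trig : Kind → ℝ → ℝ
  | .sinMinus => Real.sin
  | .sinPlus => Real.sin
  | .cosMinus => Real.cos
  | .cosPlus => Real.cos

/-- The character of the symmetric group by which each type transforms: the sign `det w` for the
antisymmetric types, and `1` for the symmetric ones. -/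
def Kind.character {n : ℕ} : Kind → Equiv.Perm (Fin n) → ℂ
  | .sinMinus => fun w => ((Equiv.Perm.sign w : ℤ) : ℂ)
  | .sinPlus => fun _ => 1
  | .cosMinus => fun w => ((Equiv.Perm.sign w : ℤ) : ℂ)
  | .cosPlus => fun _ => 1

/-- The orthant `x_i ≥ 0`, `i = 1, …, n`. -/
def orthant (n : ℕ) : Set (Fin n → ℝ) := {x | ∀ i, 0 ≤ x i}

/-- The closed chamber `x_1 ≥ x_2 ≥ ⋯ ≥ x_n ≥ 0`. -/
def chamber (n : ℕ) : Set (Fin n → ℝ) := {x | (∀ i j, i ≤ j → x j ≤ x i) ∧ ∀ i, 0 ≤ x i}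

/-- `f`, as a function on the orthant, is antisymmetric (for the two types `-`) or symmetric
(for the two types `+`) under permutations of the coordinates. -/
def Kind.HasSymmetry {n : ℕ} (k : Kind) (f : (Fin n → ℝ) → ℂ) : Prop :=
  ∀ w : Equiv.Perm (Fin n), ∀ x ∈ orthant n, f (fun i => x (w i)) = k.character w * f x

/-- The transform `lam ↦ ∫_{chamber} f(x) K_lam(x) dx`. -/
def Kind.transform {n : ℕ} (k : Kind) (f : (Fin n → ℝ) → ℂ) (lam : Fin n → ℝ) : ℂ :=
  ∫ x in chamber n, f x * (k.kernel lam x : ℂ)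

/-- The inverse transform `x ↦ 2^{2n} ∫_{chamber} g(lam) K_lam(x) d lam`. -/
def Kind.inverseTransform {n : ℕ} (k : Kind) (g : (Fin n → ℝ) → ℂ) (x : Fin n → ℝ) : ℂ :=
  2 ^ (2 * n) * ∫ lam in chamber n, g lam * (k.kernel lam x : ℂ)

/-- The Hilbert space `L²` of the chamber, for Lebesgue measure. -/
abbrev L2Chamber (n : ℕ) : Type := Lp ℂ 2 (volume.restrict (chamber n))

end MultiTrig

end

open MeasureTheory MultiTrig

/-! The chamber is, up to a null set, a fundamental domain for the group of signed permutations
acting orthogonally on `ℝⁿ`. Each kernel is a twisted average of exponentials over this group: for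
`s = ±1`, summing the exponential at `gλ` against a character of the group gives `c_s ^ n * K_λ`,
with `c_s = 2` for cosine and `c_s = 2si` for sine (`sum_signedCharacter_mul_expChar`).

Hence, if a function on the chamber is extended to `ℝⁿ` so as to transform by that character, the
Fourier transform of the extension is `c_s ^ n` times the transform (`fourierPi_extend`). Inversion
and Plancherel are then inherited from `ℝⁿ`. The constant `2 ^ (2n)` is `(c_{-1} c_1) ^ n` in the
first and `|c_{-1}| ^ (2n)` in the second; the order of the group appears on both sides of
Plancherel and cancels. The formulas over the orthant come from cutting it into `n!` permuted
chambers.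

On `L²`, `2 ^ n T` is an isometry by density, and `T` is symmetric because the kernel is real and
symmetric in its two arguments. Together these give `4 ^ n T² = 1`, so the inverse is `4 ^ n T`. -/

/-! ### Almost-everywhere Fourier inversion and Plancherel for integrable functions. -/

open scoped FourierTransform SchwartzMap in
theorem ae_eq_of_integral_schwartz_mul_eq {V : Type*} [NormedAddCommGroup V]
    [InnerProductSpace ℝ V] [FiniteDimensional ℝ V] [MeasurableSpace V] [BorelSpace V]
    {f g : V → ℂ} (hf : LocallyIntegrable f) (hg : LocallyIntegrable g)
    (h : ∀ ψ : 𝓢(V, ℂ), ∫ x, ψ x * f x = ∫ x, ψ x * g x) : f =ᵐ[volume] g := by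
  refine ae_eq_of_integral_contDiff_smul_eq hf hg fun φ hφ hc => ?_
  have hc' : HasCompactSupport (fun x => (φ x : ℂ)) := hc.comp_left (g := fun t : ℝ => (t : ℂ)) (by simp)
  have hφ' : ContDiff ℝ ((⊤ : ℕ∞) : WithTop ℕ∞) (fun x => (φ x : ℂ)) :=
    Complex.ofRealCLM.contDiff.comp hφ
  have := h (hc'.toSchwartzMap hφ')
  simpa using this

open scoped FourierTransform SchwartzMap in
theorem integral_schwartz_mul_fourier {V : Type*} [NormedAddCommGroup V]
    [InnerProductSpace ℝ V] [FiniteDimensional ℝ V] [MeasurableSpace V] [BorelSpace V]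
    {f : V → ℂ} (hf : Integrable f) (ψ : 𝓢(V, ℂ)) :
    ∫ x, ψ x * 𝓕 f x = ∫ x, (𝓕 ψ) x * f x := by
  have := VectorFourier.integral_fourierIntegral_smul_eq_flip (L := innerₗ V)
    (μ := volume) (ν := volume) Real.continuous_fourierChar
    (by exact continuous_inner) ψ.integrable hf
  simpa [flip_innerₗ] using! this.symm

-- Tested against a Schwartz function `ψ`, both transforms move onto the test function, where `𝓕 (𝓕⁻
-- ψ) = ψ` is available. No continuity of `f` is needed, at the price of an equality almost
-- everywhere.
open scoped FourierTransform SchwartzMap in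
theorem MeasureTheory.Integrable.ae_eq_fourierInv_fourier {V : Type*} [NormedAddCommGroup V]
    [InnerProductSpace ℝ V] [FiniteDimensional ℝ V] [MeasurableSpace V] [BorelSpace V]
    {f : V → ℂ} (hf : Integrable f) (hf' : Integrable (𝓕 f)) : f =ᵐ[volume] 𝓕⁻ (𝓕 f) := by
  have hcont : Continuous (𝓕⁻ (𝓕 f)) := VectorFourier.fourierIntegral_continuous
    Real.continuous_fourierChar (L := -innerₗ V) (by exact continuous_inner.neg) hf'
  refine ae_eq_of_integral_schwartz_mul_eq hf.locallyIntegrable hcont.locallyIntegrable fun ψ => ?_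
  have h1 := integral_schwartz_mul_fourier hf (𝓕⁻ ψ)
  rw [FourierTransform.fourier_fourierInv_eq] at h1
  rw [← h1]
  have h2 := VectorFourier.integral_fourierIntegral_smul_eq_flip (L := -innerₗ V)
    (μ := volume) (ν := volume) Real.continuous_fourierChar
    (by exact continuous_inner.neg) ψ.integrable hf'
  have h3 : (-innerₗ V).flip = -innerₗ V := by ext; simp [real_inner_comm]
  rw [h3] at h2
  simpa [SchwartzMap.fourierInv_coe] using! h2

-- Both versions of the transform pair with `ψ` as `f` pairs with `𝓕 ψ`: the integral by Fubini, the
-- `L²` one by its compatibility with tempered distributions.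
open scoped FourierTransform SchwartzMap in
theorem MeasureTheory.Integrable.fourier_ae_eq_toLp {V : Type*} [NormedAddCommGroup V]
    [InnerProductSpace ℝ V] [FiniteDimensional ℝ V] [MeasurableSpace V] [BorelSpace V]
    {f : V → ℂ} (hf : Integrable f) (hf2 : MemLp f 2) :
    𝓕 f =ᵐ[volume] (𝓕 (hf2.toLp f) : Lp ℂ 2) := by
  have hcont : Continuous (𝓕 f) := VectorFourier.fourierIntegral_continuous
    Real.continuous_fourierChar (L := innerₗ V) (by exact continuous_inner) hf
  refine ae_eq_of_integral_schwartz_mul_eq hcont.locallyIntegrable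
    ((Lp.memLp _).locallyIntegrable (by norm_num)) fun ψ => ?_
  have h1 := congrArg (fun T => T ψ) (Lp.fourier_toTemperedDistribution_eq (hf2.toLp f))
  simp only [TemperedDistribution.fourier_apply, Lp.toTemperedDistribution_apply,
    smul_eq_mul] at h1
  rw [← h1, integral_schwartz_mul_fourier hf]
  refine integral_congr_ae ?_
  filter_upwards [hf2.coeFn_toLp] with x hx
  rw [hx]

open scoped FourierTransform in
theorem MeasureTheory.Integrable.eLpNorm_fourier {V : Type*} [NormedAddCommGroup V]
    [InnerProductSpace ℝ V] [FiniteDimensional ℝ V] [MeasurableSpace V] [BorelSpace V]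
    {f : V → ℂ} (hf : Integrable f) (hf2 : MemLp f 2) :
    eLpNorm (𝓕 f) 2 = eLpNorm f 2 := by
  rw [eLpNorm_congr_ae (hf.fourier_ae_eq_toLp hf2), ← Lp.enorm_def,
    ← Lp.enorm_toLp (f := f) (hf := hf2), enorm_eq_iff_norm_eq, Lp.norm_fourier_eq]

/-! ### Transfer of the Fourier transform to `Fin n → ℝ`. -/

namespace MultiTrig

/-- The character `x ↦ exp (2πi s ∑ lam_i x_i)`. -/
noncomputable def expChar {n : ℕ} (s : ℝ) (lam x : Fin n → ℝ) : ℂ :=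
  Complex.exp ((2 * Real.pi * s * ∑ i, lam i * x i : ℝ) * Complex.I)

/-- The Fourier transform on `Fin n → ℝ`. -/
noncomputable def fourierPi {n : ℕ} (s : ℝ) (f : (Fin n → ℝ) → ℂ) (lam : Fin n → ℝ) : ℂ :=
  ∫ x, f x * expChar s lam x

theorem continuous_expChar {n : ℕ} (s : ℝ) (lam : Fin n → ℝ) : Continuous (expChar s lam) := by
  unfold expChar; fun_prop

theorem expChar_comm {n : ℕ} (s : ℝ) (lam x : Fin n → ℝ) : expChar s lam x = expChar s x lam := by
  simp only [expChar, mul_comm]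

theorem norm_expChar {n : ℕ} (s : ℝ) (lam x : Fin n → ℝ) : ‖expChar s lam x‖ = 1 :=
  Complex.norm_exp_ofReal_mul_I _

-- `Fin n → ℝ` has the sup norm and no inner product, so Fourier theory is imported through the
-- volume-preserving identification with `EuclideanSpace`.
open scoped FourierTransform in
theorem fourierPi_neg_one {n : ℕ} (f : (Fin n → ℝ) → ℂ) (lam : Fin n → ℝ) :
    fourierPi (-1) f lam = 𝓕 (fun x : EuclideanSpace ℝ (Fin n) => f x.ofLp) (WithLp.toLp 2 lam) := by
  rw [Real.fourier_eq', fourierPi, ← (EuclideanSpace.volume_preserving_symm_measurableEquiv_toLp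
    (Fin n)).integral_comp (MeasurableEquiv.measurableEmbedding _)]
  refine integral_congr_ae (.of_forall fun x => ?_)
  simp [expChar, PiLp.inner_apply, mul_comm]

open scoped FourierTransform in
theorem fourierPi_one {n : ℕ} (f : (Fin n → ℝ) → ℂ) (lam : Fin n → ℝ) :
    fourierPi 1 f lam = 𝓕⁻ (fun x : EuclideanSpace ℝ (Fin n) => f x.ofLp) (WithLp.toLp 2 lam) := by
  rw [Real.fourierInv_eq', fourierPi, ← (EuclideanSpace.volume_preserving_symm_measurableEquiv_toLp
    (Fin n)).integral_comp (MeasurableEquiv.measurableEmbedding _)]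
  refine integral_congr_ae (.of_forall fun x => ?_)
  simp [expChar, PiLp.inner_apply, mul_comm]

theorem ae_eq_fourierPi_fourierPi {n : ℕ} {f : (Fin n → ℝ) → ℂ} (hf : Integrable f)
    (hf' : Integrable (fourierPi (-1) f)) :
    f =ᵐ[volume] fourierPi 1 (fourierPi (-1) f) := by
  have hp := PiLp.volume_preserving_ofLp (Fin n)
  have h1 : Integrable (fun x : EuclideanSpace ℝ (Fin n) => f x.ofLp) := hp.integrable_comp_of_integrable hf
  have h2 : Integrable (fun x : EuclideanSpace ℝ (Fin n) => fourierPi (-1) f x.ofLp) :=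
    hp.integrable_comp_of_integrable hf'
  simp only [fourierPi_neg_one, WithLp.toLp_ofLp] at h2
  have h3 := h1.ae_eq_fourierInv_fourier h2
  filter_upwards [(PiLp.volume_preserving_toLp (Fin n)).quasiMeasurePreserving.ae h3] with x hx
  rw [fourierPi_one]
  simpa only [fourierPi_neg_one, WithLp.toLp_ofLp] using hx

theorem eLpNorm_fourierPi {n : ℕ} {f : (Fin n → ℝ) → ℂ} (hf : Integrable f) (hf2 : MemLp f 2) :
    eLpNorm (fourierPi (-1) f) 2 volume = eLpNorm f 2 volume := by
  have hp := PiLp.volume_preserving_ofLp (Fin n)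
  have h1 : Integrable (fun x : EuclideanSpace ℝ (Fin n) => f x.ofLp) := hp.integrable_comp_of_integrable hf
  have h2 : MemLp (fun x : EuclideanSpace ℝ (Fin n) => f x.ofLp) 2 := hf2.comp_measurePreserving hp
  have h3 := h1.eLpNorm_fourier h2
  have hcont : Continuous (fourierPi (-1) f) := by
    unfold fourierPi
    refine continuous_of_dominated (bound := fun x => ‖f x‖) (fun lam => ?_) (fun lam => ?_) hf.norm ?_
    · exact hf.1.mul (continuous_expChar _ _).aestronglyMeasurable
    · exact .of_forall fun x => by simp [norm_expChar]
    · refine .of_forall fun x => ?_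
      simp only [expChar_comm _ _ x]
      exact continuous_const.mul (continuous_expChar _ _)
  rw [← eLpNorm_comp_measurePreserving hf.1 hp, ← eLpNorm_comp_measurePreserving
    hcont.aestronglyMeasurable hp]
  refine Eq.trans ?_ h3
  congr 1
  ext x
  simp [fourierPi_neg_one]

end MultiTrig

/-! ### Signed permutations, with the chamber as fundamental domain. -/

namespace MultiTrig

/-- Signed permutations, as pairs of a permutation and a vector of signs. -/
abbrev SignedPerm (n : ℕ) : Type := Equiv.Perm (Fin n) × (Fin n → ℤˣ)

/-- The action of a signed permutation on `Fin n → ℝ`. -/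
def SignedPerm.act {n : ℕ} (g : SignedPerm n) (x : Fin n → ℝ) : Fin n → ℝ :=
  fun i => ((g.2 i : ℤ) : ℝ) * x (g.1 i)

variable {n : ℕ}

theorem abs_intUnit (u : ℤˣ) : |((u : ℤ) : ℝ)| = 1 := by
  rcases Int.units_eq_one_or u with rfl | rfl <;> simp

theorem intUnit_mul_self (u : ℤˣ) : ((u : ℤ) : ℝ) * ((u : ℤ) : ℝ) = 1 := by
  rcases Int.units_eq_one_or u with rfl | rfl <;> simp

namespace SignedPerm

theorem act_perm (w : Equiv.Perm (Fin n)) (x : Fin n → ℝ) :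
    act ((w, 1) : SignedPerm n) x = fun i => x (w i) := by
  ext i; simp [act]

theorem act_one (x : Fin n → ℝ) : act (1 : SignedPerm n) x = x := by
  ext i; simp [act]

theorem continuous_act (g : SignedPerm n) : Continuous g.act := by
  unfold act; fun_prop

theorem abs_act (g : SignedPerm n) (x : Fin n → ℝ) (i : Fin n) : |g.act x i| = |x (g.1 i)| := by
  simp [act, abs_mul, abs_intUnit]

theorem act_injective (g : SignedPerm n) : Function.Injective g.act := by
  intro x y h
  ext i
  have := congrFun h (g.1.symm i)
  simpa [act] using this

theorem measurableEmbedding_act (g : SignedPerm n) : MeasurableEmbedding g.act :=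
  g.continuous_act.measurableEmbedding g.act_injective

theorem measurePreserving_act (g : SignedPerm n) : MeasurePreserving g.act := by
  -- `piCongrLeft e` puts the entry `x a` at position `e a`, whereas `act` reads `x` at `g.1 i`;
  -- hence the inverse permutation.
  have h1 := volume_measurePreserving_piCongrLeft (fun _ : Fin n => ℝ) g.1.symm
  have h2 : MeasurePreserving (fun (x : Fin n → ℝ) (i : Fin n) => ((g.2 i : ℤ) : ℝ) * x i) := by
    refine volume_preserving_pi (f := fun i t => ((g.2 i : ℤ) : ℝ) * t) fun i => ?_
    rcases Int.units_eq_one_or (g.2 i) with h | h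
    · simpa [h] using! MeasurePreserving.id (volume : Measure ℝ)
    · simpa [h] using! Measure.measurePreserving_neg (volume : Measure ℝ)
  convert! h2.comp h1 using 1
  funext x i
  have := Equiv.piCongrLeft_apply_apply (fun _ : Fin n => ℝ) g.1.symm x (g.1 i)
  rw [Equiv.symm_apply_apply] at this
  simp only [act, MeasurableEquiv.coe_piCongrLeft, Function.comp_apply, this]

theorem sum_act_mul_act (g : SignedPerm n) (x y : Fin n → ℝ) :
    ∑ i, g.act x i * g.act y i = ∑ i, x i * y i := by
  rw [← Equiv.sum_comp g.1 fun i => x i * y i]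
  refine Finset.sum_congr rfl fun i _ => ?_
  simp only [act]
  linear_combination (x (g.1 i) * y (g.1 i)) * intUnit_mul_self (g.2 i)

end SignedPerm

open SignedPerm

theorem isClosed_chamber : IsClosed (chamber n) := by
  simp only [chamber, Set.ofPred_and, Set.ofPred_forall]
  refine IsClosed.inter (isClosed_iInter fun i => isClosed_iInter fun j => isClosed_iInter fun _ =>
    isClosed_le (continuous_apply j) (continuous_apply i)) ?_
  exact isClosed_iInter fun i => isClosed_le continuous_const (continuous_apply i)

theorem measurableSet_chamber : MeasurableSet (chamber n) := isClosed_chamber.measurableSet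

theorem chamber_subset_orthant : chamber n ⊆ orthant n := fun _ hx => hx.2

/-- The coordinates of `x` are nonzero and have distinct absolute values. -/
def Generic (x : Fin n → ℝ) : Prop :=
  (∀ i, x i ≠ 0) ∧ Function.Injective fun i => |x i|

theorem ae_linearMap_ne_zero {φ : (Fin n → ℝ) →ₗ[ℝ] ℝ} {v : Fin n → ℝ} (h : φ v ≠ 0) :
    ∀ᵐ x, φ x ≠ 0 := by
  have := Measure.addHaar_submodule (volume : Measure (Fin n → ℝ)) (LinearMap.ker φ)
    (fun ht => h (LinearMap.mem_ker.1 (ht ▸ Submodule.mem_top)))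
  rw [ae_iff]
  convert this using 2
  ext x; simp

/-- The exceptional points lie on the finitely many hyperplanes `x i = 0`, `x i = x j`, `x i = -x
j`, all null. -/
theorem ae_generic : ∀ᵐ x : Fin n → ℝ, Generic x := by
  have h1 : ∀ᵐ x : Fin n → ℝ, ∀ i, x i ≠ 0 := ae_all_iff.2 fun i =>
    ae_linearMap_ne_zero (φ := LinearMap.proj i) (v := fun _ => 1) (by simp)
  have h2 : ∀ᵐ x : Fin n → ℝ, ∀ i j, i ≠ j → x i - x j ≠ 0 := by
    refine ae_all_iff.2 fun i => ae_all_iff.2 fun j => ?_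
    by_cases hij : i = j
    · simp [hij]
    filter_upwards [ae_linearMap_ne_zero (φ := LinearMap.proj (R := ℝ) (φ := fun _ : Fin n => ℝ) i -
      LinearMap.proj j) (v := Pi.single i 1) (by simp [Ne.symm hij])] with x hx _
    simpa using hx
  have h3 : ∀ᵐ x : Fin n → ℝ, ∀ i j, i ≠ j → x i + x j ≠ 0 := by
    refine ae_all_iff.2 fun i => ae_all_iff.2 fun j => ?_
    by_cases hij : i = j
    · simp [hij]
    filter_upwards [ae_linearMap_ne_zero (φ := LinearMap.proj (R := ℝ) (φ := fun _ : Fin n => ℝ) i +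
      LinearMap.proj j) (v := Pi.single i 1) (by simp [Ne.symm hij])] with x hx _
    simpa using hx
  filter_upwards [h1, h2, h3] with x h1 h2 h3
  refine ⟨h1, fun i j hij => ?_⟩
  by_contra hne
  rcases abs_eq_abs.1 hij with h | h
  · exact h2 i j hne (by rw [h, sub_self])
  · exact h3 i j hne (by rw [h, neg_add_cancel])

/-- Sorting distinct absolute values determines the permutation, and nonnegativity of nonzero
coordinates determines the signs. -/
theorem Generic.act_unique {x : Fin n → ℝ} (hx : Generic x) {g h : SignedPerm n}
    (hg : g.act x ∈ chamber n) (hh : h.act x ∈ chamber n) : g = h := by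
  -- The minus sign turns the decreasing order of the chamber into the increasing one of the `Tuple`
  -- lemmas.
  have mono : ∀ g : SignedPerm n, g.act x ∈ chamber n → Monotone ((fun i => -|x i|) ∘ g.1) := by
    intro g hg i j hij
    simp only [Function.comp_apply, ← abs_act, abs_of_nonneg (hg.2 _)]
    exact neg_le_neg (hg.1 i j hij)
  have hw : g.1 = h.1 := by
    have := Tuple.unique_monotone (mono g hg) (mono h hh)
    ext1 i
    exact hx.2 (neg_injective (congrFun this i))
  refine Prod.ext hw (funext fun i => ?_)
  have h1 := hg.2 i
  have h2 := hh.2 i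
  have h0 := hx.1 (h.1 i)
  simp only [act, hw] at h1 h2
  rcases Int.units_eq_one_or (g.2 i) with e | e <;> rcases Int.units_eq_one_or (h.2 i) with e' | e' <;>
    rw [e] at h1 ⊢ <;> rw [e'] at h2 ⊢ <;> simp at h1 h2 <;>
    exact absurd (le_antisymm ‹_› ‹_›) (by first | exact h0 | exact h0.symm)

theorem exists_perm_act_abs_mem_chamber (x : Fin n → ℝ) :
    ∃ w : Equiv.Perm (Fin n), (fun i => |x (w i)|) ∈ chamber n := by
  refine ⟨Tuple.sort fun i => -|x i|, fun i j hij => ?_, fun i => abs_nonneg _⟩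
  exact neg_le_neg_iff.1 (Tuple.monotone_sort (fun i => -|x i|) hij)

theorem exists_act_mem_chamber (x : Fin n → ℝ) : ∃ g : SignedPerm n, g.act x ∈ chamber n := by
  obtain ⟨w, hw⟩ := exists_perm_act_abs_mem_chamber x
  refine ⟨(w, fun i => if 0 ≤ x (w i) then 1 else -1), ?_⟩
  convert hw using 2 with i
  simp only [act]
  split_ifs with h
  · simp [abs_of_nonneg h]
  · simp [abs_of_neg (not_le.1 h)]

theorem exists_perm_act_mem_chamber {x : Fin n → ℝ} (hx : x ∈ orthant n) :
    ∃ w : Equiv.Perm (Fin n), act ((w, 1) : SignedPerm n) x ∈ chamber n := by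
  obtain ⟨w, hw⟩ := exists_perm_act_abs_mem_chamber x
  refine ⟨w, ?_⟩
  rw [act_perm]
  convert hw using 2 with i
  exact (abs_of_nonneg (hx _)).symm

theorem aedisjoint_preimage_chamber {g h : SignedPerm n} (hgh : g ≠ h) :
    AEDisjoint volume (g.act ⁻¹' chamber n) (h.act ⁻¹' chamber n) :=
  measure_mono_null (fun _ hx hgen => hgh (Generic.act_unique hgen hx.1 hx.2)) ae_generic

theorem measurableSet_preimage_chamber (g : SignedPerm n) :
    MeasurableSet (g.act ⁻¹' chamber n) :=
  g.continuous_act.measurable measurableSet_chamber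

/-- The images of the chamber cover the space, by sorting, and overlap only in non-generic points.
-/
theorem volume_eq_sum_restrict : (volume : Measure (Fin n → ℝ)) =
    ∑ g : SignedPerm n, volume.restrict (g.act ⁻¹' chamber n) := by
  rw [← Measure.sum_fintype, ← Measure.restrict_iUnion_ae
    (fun _ _ h => aedisjoint_preimage_chamber h)
    fun g => (measurableSet_preimage_chamber g).nullMeasurableSet]
  have : ⋃ g : SignedPerm n, g.act ⁻¹' chamber n = Set.univ :=
    Set.eq_univ_of_forall fun x => Set.mem_iUnion.2 (exists_act_mem_chamber x)
  rw [this, Measure.restrict_univ]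

theorem restrict_orthant_eq_sum_restrict : (volume : Measure (Fin n → ℝ)).restrict (orthant n) =
    ∑ w : Equiv.Perm (Fin n), volume.restrict (act ((w, 1) : SignedPerm n) ⁻¹' chamber n) := by
  rw [← Measure.sum_fintype, ← Measure.restrict_iUnion_ae
    (fun _ _ h => aedisjoint_preimage_chamber fun h' => h (congrArg Prod.fst h'))
    fun g => (measurableSet_preimage_chamber _).nullMeasurableSet]
  congr 1
  ext x
  refine ⟨fun hx => Set.mem_iUnion.2 (exists_perm_act_mem_chamber hx), fun hx i => ?_⟩
  obtain ⟨w, hw⟩ := Set.mem_iUnion.1 hx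
  have := hw.2 (w.symm i)
  simpa [act] using this

theorem measurePreserving_act_restrict (g : SignedPerm n) :
    MeasurePreserving g.act (volume.restrict (g.act ⁻¹' chamber n)) (volume.restrict (chamber n)) :=
  g.measurePreserving_act.restrict_preimage measurableSet_chamber

end MultiTrig

/-! ### The kernels as twisted sums of exponentials over signed permutations. -/

namespace MultiTrig

variable {n : ℕ}

open SignedPerm

namespace Kind

/-- The sign by which the one-variable function transforms under a change of sign. -/
def parity : Kind → ℤˣ → ℂ
  | .sinMinus => fun u => ((u : ℤ) : ℂ)
  | .sinPlus => fun u => ((u : ℤ) : ℂ)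
  | .cosMinus => fun _ => 1
  | .cosPlus => fun _ => 1

/-- The factor relating the one-variable function to exponentials. -/
noncomputable def expFactor : Kind → ℝ → ℂ
  | .sinMinus => fun s => 2 * s * Complex.I
  | .sinPlus => fun s => 2 * s * Complex.I
  | .cosMinus => fun _ => 2
  | .cosPlus => fun _ => 2

theorem expFactor_mul (k : Kind) : k.expFactor (-1) * k.expFactor 1 = 4 := by
  cases k <;> simp [expFactor] <;> ring_nf <;> simp

theorem norm_expFactor (k : Kind) : ‖k.expFactor (-1)‖ = 2 := by
  cases k <;> simp [expFactor]

theorem parity_mul_self (k : Kind) (u : ℤˣ) : k.parity u * k.parity u = 1 := by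
  rcases Int.units_eq_one_or u with rfl | rfl <;> cases k <;> simp [parity]

theorem trig_unit_mul (k : Kind) (u : ℤˣ) (t : ℝ) :
    (k.trig (((u : ℤ) : ℝ) * t) : ℂ) = k.parity u * (k.trig t : ℂ) := by
  rcases Int.units_eq_one_or u with rfl | rfl <;> cases k <;> simp [parity, trig]

theorem norm_trig_le_one (k : Kind) (t : ℝ) : ‖(k.trig t : ℂ)‖ ≤ 1 := by
  rw [Complex.norm_real]
  cases k <;> simp [trig, Real.abs_sin_le_one, Real.abs_cos_le_one]

theorem continuous_trig (k : Kind) : Continuous k.trig := by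
  cases k <;> first | exact Real.continuous_sin | exact Real.continuous_cos

/-- Euler's formula; `s = ±1` is what allows `cos (s t) = cos t` and `sin (s t) = s * sin t`. -/
theorem sum_parity_mul_exp (k : Kind) {s : ℝ} (hs : s = 1 ∨ s = -1) (t : ℝ) :
    ∑ u : ℤˣ, k.parity u * Complex.exp ((s * (((u : ℤ) : ℝ) * t) : ℝ) * Complex.I) =
      k.expFactor s * (k.trig t : ℂ) := by
  rw [UnitsInt.univ, Finset.sum_pair (by decide)]
  have h1 : Complex.exp ((t : ℂ) * Complex.I) = Real.cos t + Real.sin t * Complex.I := by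
    rw [Complex.exp_mul_I]; simp
  have h2 : Complex.exp (-((t : ℂ) * Complex.I)) = Real.cos t - Real.sin t * Complex.I := by
    rw [← neg_mul, Complex.exp_mul_I]; simp [sub_eq_add_neg]
  rcases hs with rfl | rfl <;> cases k <;>
    simp [parity, expFactor, trig, h1, h2, -Complex.ofReal_sin, -Complex.ofReal_cos] <;> ring

theorem character_mul (k : Kind) (v w : Equiv.Perm (Fin n)) :
    k.character (v * w) = k.character v * k.character w := by
  cases k <;> simp [character]

theorem character_mul_self (k : Kind) (w : Equiv.Perm (Fin n)) :
    k.character w * k.character w = 1 := by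
  cases k <;> simp only [character, mul_one]
  all_goals rcases Int.units_eq_one_or (Equiv.Perm.sign w) with h | h <;> simp [h]

theorem kernel_eq_sum (k : Kind) (lam x : Fin n → ℝ) : (k.kernel lam x : ℂ) =
    ∑ w, k.character w * ∏ i, (k.trig (2 * Real.pi * lam (w i) * x i) : ℂ) := by
  cases k <;> simp [kernel, character, trig, MultiTrig.sinMinus, MultiTrig.sinPlus, MultiTrig.cosMinus,
    MultiTrig.cosPlus,
    Matrix.det_apply', Matrix.permanent]

theorem kernel_comm (k : Kind) (lam x : Fin n → ℝ) : k.kernel lam x = k.kernel x lam := by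
  cases k <;> simp only [kernel, MultiTrig.sinMinus, MultiTrig.sinPlus,
    MultiTrig.cosMinus, MultiTrig.cosPlus]
  · rw [← Matrix.det_transpose]; congr; ext i j; simp [mul_right_comm]
  · rw [← Matrix.permanent_transpose]; congr; ext i j; simp [mul_right_comm]
  · rw [← Matrix.det_transpose]; congr; ext i j; simp [mul_right_comm]
  · rw [← Matrix.permanent_transpose]; congr; ext i j; simp [mul_right_comm]

theorem norm_character (k : Kind) (w : Equiv.Perm (Fin n)) : ‖k.character w‖ = 1 := by
  have := congrArg norm (k.character_mul_self w)
  rw [norm_mul, norm_one] at this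
  exact (mul_self_eq_one_iff.1 this).resolve_right fun h => by linarith [norm_nonneg (k.character w)]

theorem norm_kernel_le (k : Kind) (lam x : Fin n → ℝ) :
    ‖(k.kernel lam x : ℂ)‖ ≤ (n.factorial : ℝ) := by
  rw [kernel_eq_sum]
  refine (norm_sum_le_of_le (n := fun _ => (1 : ℝ)) _ fun w _ => ?_).trans ?_
  · rw [norm_mul, norm_character, one_mul, norm_prod]
    exact Finset.prod_le_one (fun _ _ => norm_nonneg _) fun _ _ => k.norm_trig_le_one _
  · simp [Fintype.card_perm]

theorem continuous_kernel_uncurry (k : Kind) :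
    Continuous fun p : (Fin n → ℝ) × (Fin n → ℝ) => (k.kernel p.1 p.2 : ℂ) := by
  simp only [kernel_eq_sum]
  have := k.continuous_trig
  fun_prop

theorem continuous_kernel (k : Kind) (lam : Fin n → ℝ) :
    Continuous fun x => (k.kernel lam x : ℂ) :=
  k.continuous_kernel_uncurry.comp (by fun_prop : Continuous fun x => (lam, x))

/-- The character by which the kernel transforms under signed permutations. -/
def signedCharacter (k : Kind) (g : SignedPerm n) : ℂ :=
  k.character g.1 * ∏ i, k.parity (g.2 i)

theorem signedCharacter_mul_self (k : Kind) (g : SignedPerm n) :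
    k.signedCharacter g * k.signedCharacter g = 1 := by
  have : (∏ i, k.parity (g.2 i)) * ∏ i, k.parity (g.2 i) = 1 := by
    rw [← Finset.prod_mul_distrib]; simp [parity_mul_self]
  rw [signedCharacter, mul_mul_mul_comm, this, character_mul_self, one_mul]

theorem signedCharacter_perm (k : Kind) (w : Equiv.Perm (Fin n)) :
    k.signedCharacter ((w, 1) : SignedPerm n) = k.character w := by
  cases k <;> simp [signedCharacter, parity]

theorem signedCharacter_one (k : Kind) : k.signedCharacter (1 : SignedPerm n) = 1 := by
  cases k <;> simp [signedCharacter, parity, character]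

theorem norm_signedCharacter (k : Kind) (g : SignedPerm n) : ‖k.signedCharacter g‖ = 1 := by
  have := congrArg norm (k.signedCharacter_mul_self g)
  rw [norm_mul, norm_one] at this
  exact (mul_self_eq_one_iff.1 this).resolve_right
    fun h => by linarith [norm_nonneg (k.signedCharacter g)]

/-- Right translation by `g.1` in the sum over permutations produces the character, and each factor
releases its own sign by parity. -/
theorem kernel_act (k : Kind) (g : SignedPerm n) (lam x : Fin n → ℝ) :
    (k.kernel lam (g.act x) : ℂ) = k.signedCharacter g * (k.kernel lam x : ℂ) := by
  rw [kernel_eq_sum, kernel_eq_sum, ← Equiv.sum_comp (Equiv.mulRight g.1), Finset.mul_sum]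
  refine Finset.sum_congr rfl fun v _ => ?_
  rw [Equiv.coe_mulRight, character_mul, signedCharacter,
    ← Equiv.prod_comp g.1 fun i => (k.trig (2 * Real.pi * lam (v i) * x i) : ℂ)]
  have : ∀ i, (k.trig (2 * Real.pi * lam ((v * g.1) i) * g.act x i) : ℂ) =
      k.parity (g.2 i) * (k.trig (2 * Real.pi * lam (v (g.1 i)) * x (g.1 i)) : ℂ) := fun i => by
    rw [← trig_unit_mul]
    congr 2
    simp only [act, Equiv.Perm.coe_mul, Function.comp_apply]
    ring
  simp only [this, Finset.prod_mul_distrib]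
  ring

theorem kernel_act_left (k : Kind) (g : SignedPerm n) (lam x : Fin n → ℝ) :
    (k.kernel (g.act lam) x : ℂ) = k.signedCharacter g * (k.kernel lam x : ℂ) := by
  rw [kernel_comm, kernel_act, kernel_comm]

/-- For a fixed permutation the sum over sign vectors of a product factors into one two-term sum per
coordinate, each a multiple of the sine or cosine; the sum over permutations left over is the
determinant or permanent. -/
theorem sum_signedCharacter_mul_expChar (k : Kind) {s : ℝ} (hs : s = 1 ∨ s = -1)
    (lam x : Fin n → ℝ) :
    ∑ g : SignedPerm n, k.signedCharacter g * expChar s (g.act lam) x =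
      k.expFactor s ^ n * (k.kernel lam x : ℂ) := by
  rw [Fintype.sum_prod_type, kernel_eq_sum, Finset.mul_sum]
  refine Finset.sum_congr rfl fun w _ => ?_
  have h1 : ∀ e : Fin n → ℤˣ, k.signedCharacter (w, e) * expChar s (act (w, e) lam) x =
      k.character w * ∏ i, (k.parity (e i) * Complex.exp
        ((s * (((e i : ℤ) : ℝ) * (2 * Real.pi * lam (w i) * x i)) : ℝ) * Complex.I)) := fun e => by
    rw [Finset.prod_mul_distrib, ← Complex.exp_sum, signedCharacter, expChar, mul_assoc,
      ← Finset.sum_mul, ← Complex.ofReal_sum]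
    congr 6
    rw [Finset.mul_sum]
    refine Finset.sum_congr rfl fun i _ => ?_
    simp only [act]
    ring
  simp only [h1]
  rw [← Finset.mul_sum, ← Fintype.piFinset_univ, ← Finset.prod_univ_sum (fun _ => Finset.univ)
    fun i (u : ℤˣ) => (k.parity u * Complex.exp
        ((s * (((u : ℤ) : ℝ) * (2 * Real.pi * lam (w i) * x i)) : ℝ) * Complex.I))]
  simp only [k.sum_parity_mul_exp hs, Finset.prod_mul_distrib, Finset.prod_const, Finset.card_univ,
    Fintype.card_fin]
  ring

end Kind

theorem expChar_act_act (g : SignedPerm n) (s : ℝ) (lam x : Fin n → ℝ) :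
    expChar s (g.act lam) (g.act x) = expChar s lam x := by
  simp only [expChar, sum_act_mul_act]

end MultiTrig

/-! ### Equivariant extension; inversion and Plancherel on the chamber. -/

namespace MultiTrig

variable {n : ℕ}

open SignedPerm

namespace Kind

variable (k : Kind)

/-- The extension of a function on the chamber to the whole space which transforms by the
character of signed permutations. -/
noncomputable def extend (f : (Fin n → ℝ) → ℂ) (x : Fin n → ℝ) : ℂ :=
  ∑ g : SignedPerm n, k.signedCharacter g * (chamber n).indicator f (g.act x)

theorem extend_of_generic {f : (Fin n → ℝ) → ℂ} {x : Fin n → ℝ} (hx : Generic x)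
    {g : SignedPerm n} (hg : g.act x ∈ chamber n) :
    k.extend f x = k.signedCharacter g * f (g.act x) := by
  rw [extend, Finset.sum_eq_single g, Set.indicator_of_mem hg]
  · intro h _ hne
    rw [Set.indicator_of_notMem fun hh => hne (hx.act_unique hh hg), mul_zero]
  · simp

/-- Meant for the transform itself, which is equivariant on all of `ℝⁿ` and so agrees with the
extension of its restriction to the chamber. -/
theorem extend_ae_eq_of_act {f : (Fin n → ℝ) → ℂ}
    (hf : ∀ g : SignedPerm n, ∀ x, f (g.act x) = k.signedCharacter g * f x) :
    k.extend f =ᵐ[volume] f := by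
  filter_upwards [ae_generic] with x hx
  obtain ⟨g, hg⟩ := exists_act_mem_chamber x
  rw [k.extend_of_generic hx hg, hf, ← mul_assoc, signedCharacter_mul_self, one_mul]

theorem extend_ae_eq_chamber (f : (Fin n → ℝ) → ℂ) :
    k.extend f =ᵐ[volume.restrict (chamber n)] f := by
  filter_upwards [ae_restrict_of_ae ae_generic, ae_restrict_mem measurableSet_chamber] with x hx hc
  rw [k.extend_of_generic hx (g := 1) (by rwa [act_one]), signedCharacter_one, act_one, one_mul]

theorem integrable_extend {f : (Fin n → ℝ) → ℂ} (hf : IntegrableOn f (chamber n)) :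
    Integrable (k.extend f) := by
  refine integrable_finsetSum _ fun g _ => Integrable.const_mul ?_ _
  exact g.measurePreserving_act.integrable_comp_of_integrable
    (hf.integrable_indicator measurableSet_chamber)

theorem memLp_extend {f : (Fin n → ℝ) → ℂ} (hf : MemLp f 2 (volume.restrict (chamber n))) :
    MemLp (k.extend f) 2 := by
  refine memLp_finsetSum _ fun g _ => MemLp.const_mul ?_ _
  exact ((memLp_indicator_iff_restrict measurableSet_chamber).2 hf).comp_measurePreserving
    g.measurePreserving_act

theorem integrable_mul_kernel {μ : Measure (Fin n → ℝ)} {f : (Fin n → ℝ) → ℂ}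
    (hf : Integrable f μ) (lam : Fin n → ℝ) :
    Integrable (fun x => f x * (k.kernel lam x : ℂ)) μ :=
  hf.mul_bdd (c := (n.factorial : ℝ)) (k.continuous_kernel lam).aestronglyMeasurable
    (.of_forall fun x => k.norm_kernel_le lam x)

/-- Substituting `y = g x` in each summand moves `g` from the function to the frequency, as `g` is
orthogonal; the sum over `g` then acts on the exponential alone and builds the kernel. -/
theorem fourierPi_extend {f : (Fin n → ℝ) → ℂ} (hf : IntegrableOn f (chamber n)) {s : ℝ}
    (hs : s = 1 ∨ s = -1) (lam : Fin n → ℝ) :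
    fourierPi s (k.extend f) lam = k.expFactor s ^ n * k.transform f lam := by
  have hi := hf.integrable_indicator measurableSet_chamber
  have hint : ∀ mu, Integrable fun x => (chamber n).indicator f x * expChar s mu x := fun mu =>
    hi.mul_bdd (c := 1) (continuous_expChar _ _).aestronglyMeasurable
      (.of_forall fun x => (norm_expChar _ _ _).le)
  have hg : ∀ g : SignedPerm n, ∀ x, (chamber n).indicator f (g.act x) * expChar s lam x =
      (fun y => (chamber n).indicator f y * expChar s (g.act lam) y) (g.act x) := fun g x => by
    simp only [expChar_act_act]
  have hint' : ∀ g : SignedPerm n,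
      Integrable fun x => (chamber n).indicator f (g.act x) * expChar s lam x := fun g => by
    simp only [hg]
    exact g.measurePreserving_act.integrable_comp_of_integrable (hint (g.act lam))
  simp only [fourierPi, extend, Finset.sum_mul, mul_assoc]
  rw [integral_finsetSum _ fun g _ => (hint' g).const_mul _]
  have hI : ∀ g : SignedPerm n, ∫ x, (chamber n).indicator f (g.act x) * expChar s lam x =
      ∫ y, (chamber n).indicator f y * expChar s (g.act lam) y := fun g => by
    simp only [hg]
    exact g.measurePreserving_act.integral_comp g.measurableEmbedding_act
      (fun y => (chamber n).indicator f y * expChar s (g.act lam) y)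
  simp only [integral_const_mul, hI]
  simp only [← integral_const_mul]
  rw [← integral_finsetSum _ fun g _ => (hint _).const_mul _, transform,
    ← integral_const_mul, ← integral_indicator measurableSet_chamber]
  refine integral_congr_ae (.of_forall fun x => ?_)
  simp only [mul_left_comm _ ((chamber n).indicator f x), ← Finset.mul_sum,
    k.sum_signedCharacter_mul_expChar hs]
  by_cases hx : x ∈ chamber n
  · simp only [Set.indicator_of_mem hx]; ring
  · simp [Set.indicator_of_notMem hx]

theorem transform_act (f : (Fin n → ℝ) → ℂ) (g : SignedPerm n) (lam : Fin n → ℝ) :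
    k.transform f (g.act lam) = k.signedCharacter g * k.transform f lam := by
  simp only [transform, kernel_act_left, ← integral_const_mul, mul_left_comm]

theorem inverseTransform_eq (f : (Fin n → ℝ) → ℂ) (x : Fin n → ℝ) :
    k.inverseTransform f x = 2 ^ (2 * n) * k.transform f x := by
  simp only [inverseTransform, transform, k.kernel_comm _ x]

theorem continuous_transform {f : (Fin n → ℝ) → ℂ} (hf : IntegrableOn f (chamber n)) :
    Continuous (k.transform f) := by
  unfold transform
  refine continuous_of_dominated (bound := fun x => ‖f x‖ * (n.factorial : ℝ)) (fun lam => ?_)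
    (fun lam => .of_forall fun x => ?_) (hf.norm.mul_const _) (.of_forall fun x => ?_)
  · exact (k.integrable_mul_kernel hf lam).1
  · rw [norm_mul]
    exact mul_le_mul_of_nonneg_left (k.norm_kernel_le _ _) (norm_nonneg _)
  · simp only [k.kernel_comm _ x]
    exact continuous_const.mul (k.continuous_kernel x)

theorem continuous_inverseTransform {f : (Fin n → ℝ) → ℂ} (hf : IntegrableOn f (chamber n)) :
    Continuous (k.inverseTransform f) := by
  simp only [funext (k.inverseTransform_eq f)]
  exact continuous_const.mul (k.continuous_transform hf)

theorem ae_eq_inverseTransform {f : (Fin n → ℝ) → ℂ} (hf : IntegrableOn f (chamber n))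
    (hf' : IntegrableOn (k.transform f) (chamber n)) :
    ∀ᵐ x ∂volume.restrict (chamber n), f x = k.inverseTransform (k.transform f) x := by
  have hae := k.extend_ae_eq_of_act (k.transform_act f)
  have h1 : fourierPi (-1) (k.extend f) =
      fun lam => k.expFactor (-1) ^ n * k.transform f lam :=
    funext (k.fourierPi_extend hf (.inr rfl))
  have h2 : Integrable (fourierPi (-1) (k.extend f)) := by
    rw [h1]
    exact ((k.integrable_extend hf').congr hae).const_mul _
  have h3 := ae_eq_fourierPi_fourierPi (k.integrable_extend hf) h2
  filter_upwards [ae_restrict_of_ae h3, k.extend_ae_eq_chamber f] with x hx hx'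
  -- Recognising the transform as an extension allows `fourierPi_extend` a second time, now with `s
  -- = 1`.
  have h4 : fourierPi 1 (k.transform f) x = fourierPi 1 (k.extend (k.transform f)) x :=
    integral_congr_ae (by filter_upwards [hae] with y hy; rw [hy])
  rw [← hx', hx, h1, inverseTransform_eq]
  simp only [fourierPi, mul_assoc, integral_const_mul]
  change _ * fourierPi 1 (k.transform f) x = _
  rw [h4, k.fourierPi_extend hf' (.inl rfl), ← mul_assoc, ← mul_pow, expFactor_mul, pow_mul]
  norm_num

/-- The character has modulus one, so every image of the chamber contributes equally. -/
theorem lintegral_extend_sq (f : (Fin n → ℝ) → ℂ) :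
    ∫⁻ x, ‖k.extend f x‖ₑ ^ 2 =
      Fintype.card (SignedPerm n) * ∫⁻ x in chamber n, ‖f x‖ₑ ^ 2 := by
  have h : ∀ g : SignedPerm n, ∫⁻ x in g.act ⁻¹' chamber n, ‖k.extend f x‖ₑ ^ 2 =
      ∫⁻ x in chamber n, ‖f x‖ₑ ^ 2 := fun g => by
    rw [← (measurePreserving_act_restrict g).lintegral_comp_emb g.measurableEmbedding_act]
    refine lintegral_congr_ae ?_
    filter_upwards [ae_restrict_of_ae ae_generic,
      ae_restrict_mem (measurableSet_preimage_chamber g)] with x hx hc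
    have : ‖k.signedCharacter g‖ₑ = 1 := by
      rw [← ofReal_norm, norm_signedCharacter, ENNReal.ofReal_one]
    rw [k.extend_of_generic hx hc, enorm_mul, this, one_mul]
  conv_lhs => rw [volume_eq_sum_restrict]
  rw [lintegral_finsetSum_measure]
  simp only [h, Finset.sum_const, Finset.card_univ, nsmul_eq_mul]

theorem lintegral_transform_sq {f : (Fin n → ℝ) → ℂ} (hf : IntegrableOn f (chamber n))
    (hf2 : MemLp f 2 (volume.restrict (chamber n))) :
    ∫⁻ x in chamber n, ‖f x‖ₑ ^ 2 =
      2 ^ (2 * n) * ∫⁻ lam in chamber n, ‖k.transform f lam‖ₑ ^ 2 := by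
  have hae := k.extend_ae_eq_of_act (k.transform_act f)
  have h1 : fourierPi (-1) (k.extend f) =
      fun lam => k.expFactor (-1) ^ n * k.transform f lam :=
    funext (k.fourierPi_extend hf (.inr rfl))
  have h2 := eLpNorm_fourierPi (k.integrable_extend hf) (k.memLp_extend hf2)
  have h3 : ∫⁻ x, ‖fourierPi (-1) (k.extend f) x‖ₑ ^ 2 = ∫⁻ x, ‖k.extend f x‖ₑ ^ 2 := by
    simp only [eLpNorm_eq_lintegral_rpow_enorm_toReal (p := 2) (by simp) (by simp)] at h2
    simpa using ENNReal.rpow_left_injective (by simp) h2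
  have h4 : ‖k.expFactor (-1)‖ₑ = 2 := by
    rw [← ofReal_norm, norm_expFactor]; simp
  have h5 : ∫⁻ x, ‖k.transform f x‖ₑ ^ 2 = ∫⁻ x, ‖k.extend (k.transform f) x‖ₑ ^ 2 :=
    lintegral_congr_ae (by filter_upwards [hae] with x hx; rw [hx])
  rw [h1, lintegral_extend_sq] at h3
  simp only [enorm_mul, enorm_pow, h4, mul_pow] at h3
  rw [lintegral_const_mul' _ _ (by finiteness), h5, lintegral_extend_sq, mul_left_comm,
    ← pow_mul, mul_comm n] at h3
  -- The order of the group, nonzero and finite, cancels.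
  exact ((ENNReal.mul_right_inj (by simp) (ENNReal.natCast_ne_top _)).1 h3).symm

theorem memLp_transform {f : (Fin n → ℝ) → ℂ} (hf : IntegrableOn f (chamber n))
    (hf2 : MemLp f 2 (volume.restrict (chamber n))) :
    MemLp (k.transform f) 2 (volume.restrict (chamber n)) := by
  refine ⟨(k.continuous_transform hf).aestronglyMeasurable, ?_⟩
  have h := hf2.2
  rw [eLpNorm_lt_top_iff_lintegral_rpow_enorm_lt_top (by simp) (by simp)] at h ⊢
  simp only [ENNReal.toReal_ofNat, ENNReal.rpow_ofNat] at h ⊢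
  rw [k.lintegral_transform_sq hf hf2] at h
  exact ENNReal.lt_top_of_mul_ne_top_right h.ne (by simp)

theorem integral_transform_sq {f : (Fin n → ℝ) → ℂ} (hf : IntegrableOn f (chamber n))
    (hf2 : MemLp f 2 (volume.restrict (chamber n))) :
    ∫ x in chamber n, ‖f x‖ ^ 2 = 2 ^ (2 * n) * ∫ lam in chamber n, ‖k.transform f lam‖ ^ 2 := by
  have key : ∀ {h : (Fin n → ℝ) → ℂ}, AEStronglyMeasurable h (volume.restrict (chamber n)) →
      ∫ x in chamber n, ‖h x‖ ^ 2 = (∫⁻ x in chamber n, ‖h x‖ₑ ^ 2).toReal := fun {h} hh => by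
    rw [integral_eq_lintegral_of_nonneg_ae (.of_forall fun x => by positivity)
      ((continuous_pow 2).comp_aestronglyMeasurable hh.norm)]
    congr 1
    refine lintegral_congr fun x => ?_
    rw [ENNReal.ofReal_pow (norm_nonneg _), ofReal_norm]
  rw [key hf2.1, key (k.continuous_transform hf).aestronglyMeasurable,
    k.lintegral_transform_sq hf hf2, ENNReal.toReal_mul]
  simp

end Kind

end MultiTrig

/-! ### Points of continuity, and symmetric functions on the orthant. -/

namespace MultiTrig

variable {n : ℕ}

open SignedPerm

/-- The points `x + p / (m + 1)` are interior and tend to `x`. -/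
theorem subset_closure_interior_of_translate {S O : Set (Fin n → ℝ)} (hO : IsOpen O) (hOS : O ⊆ S)
    (p : Fin n → ℝ) (h : ∀ x ∈ S, ∀ t : ℝ, 0 < t → x + t • p ∈ O) :
    S ⊆ closure (interior S) := by
  intro x hx
  have ht : Filter.Tendsto (fun m : ℕ => x + (1 / ((m : ℝ) + 1)) • p) Filter.atTop (nhds x) := by
    simpa using (tendsto_one_div_add_atTop_nhds_zero_nat (𝕜 := ℝ)).smul_const p |>.const_add x
  exact mem_closure_of_tendsto ht
    (.of_forall fun m => interior_maximal hOS hO (h x hx _ Nat.one_div_pos_of_nat))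

theorem orthant_subset_closure_interior : orthant n ⊆ closure (interior (orthant n)) := by
  refine subset_closure_interior_of_translate (O := {x | ∀ i, 0 < x i}) ?_
    (fun x hx i => (hx i).le) (fun _ => 1) fun x hx t ht i => ?_
  · simp only [Set.ofPred_forall]
    exact isOpen_iInter_of_finite fun i => isOpen_lt continuous_const (continuous_apply i)
  · simpa using add_pos_of_nonneg_of_pos (hx i) ht

theorem chamber_subset_closure_interior : chamber n ⊆ closure (interior (chamber n)) := by
  refine subset_closure_interior_of_translate
    (O := {x | (∀ i j, i < j → x j < x i) ∧ ∀ i, 0 < x i}) ?_ ?_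
    -- Indices run from `0` to `n - 1`, so this direction is strictly decreasing with last entry
    -- `1`.
    (fun i => (n : ℝ) - i) fun x hx t ht => ⟨fun i j hij => ?_, fun i => ?_⟩
  · simp only [Set.ofPred_and, Set.ofPred_forall]
    refine IsOpen.inter (isOpen_iInter_of_finite fun i => isOpen_iInter_of_finite fun j =>
      isOpen_iInter_of_finite fun _ => isOpen_lt (continuous_apply j) (continuous_apply i)) ?_
    exact isOpen_iInter_of_finite fun i => isOpen_lt continuous_const (continuous_apply i)
  · refine fun x hx => ⟨fun i j hij => ?_, fun i => (hx.2 i).le⟩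
    rcases hij.eq_or_lt with rfl | h
    · exact le_rfl
    · exact (hx.1 i j h).le
  · have h1 := hx.1 i j hij.le
    have h2 : ((i : ℕ) : ℝ) < ((j : ℕ) : ℝ) := by exact_mod_cast hij
    simp only [Pi.add_apply, Pi.smul_apply, smul_eq_mul]
    nlinarith
  · have h1 := hx.2 i
    have h2 : ((i : ℕ) : ℝ) < (n : ℝ) := by exact_mod_cast i.2
    simp only [Pi.add_apply, Pi.smul_apply, smul_eq_mul]
    nlinarith

/-- A null set contains no nonempty open set, so the points of agreement accumulate at `x`, even on
the boundary of `S`; limits along them coincide. -/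
theorem eq_of_ae_eq_of_continuousWithinAt {S : Set (Fin n → ℝ)} (hS : S ⊆ closure (interior S))
    {f h : (Fin n → ℝ) → ℂ} (hae : ∀ᵐ x ∂volume.restrict S, f x = h x) (hh : Continuous h)
    {x : Fin n → ℝ} (hx : x ∈ S) (hf : ContinuousWithinAt f S x) : f x = h x := by
  have hae' : ∀ᵐ y, y ∈ interior S → f y = h y :=
    (ae_restrict_iff' isOpen_interior.measurableSet).1
      (ae_restrict_of_ae_restrict_of_subset interior_subset hae)
  have hcl : x ∈ closure {y | y ∈ S ∧ f y = h y} := by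
    refine mem_closure_iff.2 fun U hU hxU => ?_
    have hne : (U ∩ interior S).Nonempty := mem_closure_iff.1 (hS hx) U hU hxU
    by_contra hemp
    refine ((hU.inter isOpen_interior).measure_pos volume hne).ne' (measure_mono_null ?_ hae')
    exact fun y hy hy' => hemp ⟨y, hy.1, interior_subset hy.2, hy' hy.2⟩
  have : (nhdsWithin x {y | y ∈ S ∧ f y = h y}).NeBot := mem_closure_iff_nhdsWithin_neBot.1 hcl
  refine tendsto_nhds_unique_of_eventuallyEq (hf.mono fun y hy => hy.1)
    (hh.continuousWithinAt (s := {y | y ∈ S ∧ f y = h y})) ?_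
  filter_upwards [self_mem_nhdsWithin] with y hy using hy.2

namespace Kind

variable {k : Kind}

theorem HasSymmetry.eq_on_preimage {f : (Fin n → ℝ) → ℂ} (hf : k.HasSymmetry f)
    (w : Equiv.Perm (Fin n)) {x : Fin n → ℝ}
    (hx : x ∈ act ((w, 1) : SignedPerm n) ⁻¹' chamber n) :
    f x = k.character w * f (act ((w, 1) : SignedPerm n) x) := by
  have hx' : x ∈ orthant n := fun i => by
    have := chamber_subset_orthant hx (w.symm i)
    simpa [act] using this
  rw [act_perm, hf w x hx', ← mul_assoc, character_mul_self, one_mul]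

theorem HasSymmetry.integrableOn_preimage {f : (Fin n → ℝ) → ℂ} (hf : k.HasSymmetry f)
    (hi : IntegrableOn f (chamber n)) (w : Equiv.Perm (Fin n)) :
    IntegrableOn f (act ((w, 1) : SignedPerm n) ⁻¹' chamber n) := by
  have h := ((measurePreserving_act_restrict ((w, 1) : SignedPerm n)).integrable_comp_of_integrable
    hi).const_mul (k.character w)
  refine h.congr ?_
  filter_upwards [ae_restrict_mem (measurableSet_preimage_chamber _)] with x hx
  exact (hf.eq_on_preimage w hx).symm

theorem HasSymmetry.integrableOn_orthant {f : (Fin n → ℝ) → ℂ} (hf : k.HasSymmetry f)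
    (hi : IntegrableOn f (chamber n)) : IntegrableOn f (orthant n) := by
  rw [IntegrableOn, restrict_orthant_eq_sum_restrict, integrable_finsetSum_measure]
  exact fun w _ => hf.integrableOn_preimage hi w

/-- Each permuted chamber is carried back to the chamber by `w`: `f` yields the character and `ψ` is
composed with `w⁻¹`. Taking for `ψ` the kernel gives `n!` equal terms; taking the product of sines
or cosines rebuilds the kernel. -/
theorem HasSymmetry.integral_orthant_mul {f : (Fin n → ℝ) → ℂ} (hf : k.HasSymmetry f)
    (hi : IntegrableOn f (chamber n)) {ψ : (Fin n → ℝ) → ℂ} (hψ : Continuous ψ) {C : ℝ}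
    (hC : ∀ x, ‖ψ x‖ ≤ C) :
    ∫ x in orthant n, f x * ψ x =
      ∫ x in chamber n, f x * ∑ w : Equiv.Perm (Fin n),
        k.character w * ψ (act ((w⁻¹, 1) : SignedPerm n) x) := by
  rw [restrict_orthant_eq_sum_restrict, integral_finsetSum_measure fun w _ =>
    (hf.integrableOn_preimage hi w).mul_bdd (c := C) hψ.aestronglyMeasurable (.of_forall hC)]
  simp only [Finset.mul_sum]
  rw [integral_finsetSum]
  · refine Finset.sum_congr rfl fun w _ => ?_
    rw [← (measurePreserving_act_restrict ((w, 1) : SignedPerm n)).integral_comp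
      (measurableEmbedding_act _)]
    refine integral_congr_ae ?_
    filter_upwards [ae_restrict_mem (measurableSet_preimage_chamber _)] with x hx
    have : act ((w⁻¹, 1) : SignedPerm n) (act ((w, 1) : SignedPerm n) x) = x := by
      ext i; simp [act]
    rw [this, hf.eq_on_preimage w hx]
    ring
  · intro w _
    refine hi.mul_bdd (c := C) ?_ (.of_forall fun x => ?_)
    · exact (continuous_const.mul (hψ.comp (continuous_act _))).aestronglyMeasurable
    · rw [norm_mul, norm_character, one_mul]
      exact hC _

theorem HasSymmetry.transform_eq_integral_kernel {f : (Fin n → ℝ) → ℂ} (hf : k.HasSymmetry f)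
    (hi : IntegrableOn f (chamber n)) (lam : Fin n → ℝ) :
    k.transform f lam =
      (Nat.factorial n : ℂ)⁻¹ * ∫ x in orthant n, f x * (k.kernel lam x : ℂ) := by
  have h : ∀ (x : Fin n → ℝ) (w : Equiv.Perm (Fin n)),
      k.character w * (k.kernel lam (act ((w⁻¹, 1) : SignedPerm n) x) : ℂ) =
        (k.kernel lam x : ℂ) := fun x w => by
    have h1 : k.character w * k.character w⁻¹ = 1 := by
      rw [← character_mul, mul_inv_cancel, ← k.signedCharacter_perm]
      exact k.signedCharacter_one
    rw [kernel_act, signedCharacter_perm, ← mul_assoc, h1, one_mul]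
  have hn : (Nat.factorial n : ℂ) ≠ 0 := by exact_mod_cast n.factorial_ne_zero
  rw [hf.integral_orthant_mul hi (k.continuous_kernel lam) (k.norm_kernel_le lam)]
  simp only [h, Finset.sum_const, Finset.card_univ, Fintype.card_perm, Fintype.card_fin,
    nsmul_eq_mul]
  simp only [mul_left_comm _ (Nat.factorial n : ℂ), integral_const_mul]
  rw [← mul_assoc, mul_inv_cancel₀ hn, one_mul, transform]

theorem HasSymmetry.transform_eq_integral_prod {f : (Fin n → ℝ) → ℂ} (hf : k.HasSymmetry f)
    (hi : IntegrableOn f (chamber n)) (lam : Fin n → ℝ) :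
    k.transform f lam =
      ∫ x in orthant n, f x * ∏ i, (k.trig (2 * Real.pi * lam i * x i) : ℂ) := by
  have hc : Continuous fun x : Fin n → ℝ => ∏ i, (k.trig (2 * Real.pi * lam i * x i) : ℂ) := by
    have := k.continuous_trig
    fun_prop
  have hC : ∀ x : Fin n → ℝ, ‖∏ i, (k.trig (2 * Real.pi * lam i * x i) : ℂ)‖ ≤ 1 := fun x => by
    rw [norm_prod]
    exact Finset.prod_le_one (fun _ _ => norm_nonneg _) fun _ _ => k.norm_trig_le_one _
  rw [hf.integral_orthant_mul hi hc hC, transform]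
  simp only [kernel_eq_sum]
  congr! 5 with x w
  rw [← Equiv.prod_comp w fun i => (k.trig (2 * Real.pi * lam i *
    act ((w⁻¹, 1) : SignedPerm n) x i) : ℂ)]
  simp [act_perm]

theorem transform_perm (k : Kind) (f : (Fin n → ℝ) → ℂ) (lam : Fin n → ℝ)
    (w : Equiv.Perm (Fin n)) :
    k.transform f (fun i => lam (w i)) = k.character w * k.transform f lam := by
  rw [← act_perm, transform_act, signedCharacter_perm]

theorem HasSymmetry.ae_eq_inverseTransform {f : (Fin n → ℝ) → ℂ} (hf : k.HasSymmetry f)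
    (hi : IntegrableOn f (chamber n)) (hi' : IntegrableOn (k.transform f) (chamber n)) :
    ∀ᵐ x ∂volume.restrict (orthant n), f x = k.inverseTransform (k.transform f) x := by
  rw [restrict_orthant_eq_sum_restrict, ← Measure.sum_fintype, Measure.ae_sum_iff]
  intro w
  filter_upwards [(measurePreserving_act_restrict ((w, 1) : SignedPerm n)).quasiMeasurePreserving.ae
    (k.ae_eq_inverseTransform hi hi'), ae_restrict_mem (measurableSet_preimage_chamber _)]
    with x hx hx'
  rw [hf.eq_on_preimage w hx', hx, inverseTransform_eq, inverseTransform_eq, transform_act,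
    signedCharacter_perm, mul_left_comm (2 ^ (2 * n)), ← mul_assoc, character_mul_self, one_mul]

/-! ### The `L²` theory. -/

variable (k : Kind)

theorem transform_congr {f g : (Fin n → ℝ) → ℂ} (h : f =ᵐ[volume.restrict (chamber n)] g) :
    k.transform f = k.transform g := by
  ext lam
  exact integral_congr_ae (by filter_upwards [h] with x hx; rw [hx])

theorem transform_add {f g : (Fin n → ℝ) → ℂ} (hf : IntegrableOn f (chamber n))
    (hg : IntegrableOn g (chamber n)) :
    k.transform (f + g) = k.transform f + k.transform g := by
  ext lam
  simp only [transform, Pi.add_apply, add_mul]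
  exact integral_add (k.integrable_mul_kernel hf lam) (k.integrable_mul_kernel hg lam)

theorem transform_smul (c : ℂ) (f : (Fin n → ℝ) → ℂ) :
    k.transform (c • f) = c • k.transform f := by
  ext lam
  simp only [transform, Pi.smul_apply, smul_eq_mul, mul_assoc, integral_const_mul]

/-- Fubini, with a bounded kernel that is real and symmetric in its arguments. -/
theorem integral_mul_conj_transform {f g : (Fin n → ℝ) → ℂ} (hf : IntegrableOn f (chamber n))
    (hg : IntegrableOn g (chamber n)) :
    ∫ x in chamber n, g x * (starRingEnd ℂ) (k.transform f x) =
      ∫ x in chamber n, k.transform g x * (starRingEnd ℂ) (f x) := by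
  have h1 : ∀ x, g x * (starRingEnd ℂ) (k.transform f x) =
      ∫ y in chamber n, g x * (starRingEnd ℂ) (f y) * (k.kernel x y : ℂ) := fun x => by
    simp only [transform, ← integral_conj, map_mul, Complex.conj_ofReal, mul_assoc,
      integral_const_mul]
  have h2 : ∀ y, k.transform g y * (starRingEnd ℂ) (f y) =
      ∫ x in chamber n, g x * (starRingEnd ℂ) (f y) * (k.kernel x y : ℂ) := fun y => by
    simp only [transform, ← integral_mul_const, k.kernel_comm y, mul_right_comm]
  simp only [h1, h2]
  refine integral_integral_swap ?_
  have hf' : IntegrableOn (fun x => (starRingEnd ℂ) (f x)) (chamber n) :=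
    (Complex.conjLIE.integrable_comp_iff).2 hf
  exact (Integrable.mul_prod hg hf').mul_bdd (c := (n.factorial : ℝ))
    k.continuous_kernel_uncurry.aestronglyMeasurable (.of_forall fun p => k.norm_kernel_le _ _)

end Kind

/-- The square integrable functions on the chamber that are integrable. -/
def integrableL2 (n : ℕ) : Submodule ℂ (L2Chamber n) where
  carrier := {g | Integrable g (volume.restrict (chamber n))}
  zero_mem' := (integrable_zero _ _ _).congr (Lp.coeFn_zero _ _ _).symm
  add_mem' := fun {f g} hf hg => (Integrable.add hf hg).congr (Lp.coeFn_add f g).symm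
  smul_mem' := fun c f hf => (Integrable.smul c hf).congr (Lp.coeFn_smul c f).symm

theorem denseRange_integrableL2 : DenseRange (integrableL2 n).subtype := by
  refine (Lp.simpleFunc.denseRange (E := ℂ) (μ := volume.restrict (chamber n)) (p := 2)
    (by simp)).mono ?_
  rintro _ ⟨s, rfl⟩
  refine ⟨⟨s, ?_⟩, rfl⟩
  exact ((SimpleFunc.memLp_iff_integrable (by simp) (by simp)).1 (Lp.simpleFunc.memLp s)).congr
    (Lp.simpleFunc.toSimpleFunc_eq_toFun s)

theorem integral_norm_sq_eq_norm_sq (g : L2Chamber n) :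
    ∫ x in chamber n, ‖g x‖ ^ 2 = ‖g‖ ^ 2 := by
  have h := inner_self_eq_norm_sq_to_K (𝕜 := ℂ) g
  rw [L2.inner_def] at h
  simp only [inner_self_eq_norm_sq_to_K] at h
  have h' : ((∫ x in chamber n, ‖g x‖ ^ 2 : ℝ) : ℂ) = ((‖g‖ ^ 2 : ℝ) : ℂ) := by
    rw [← integral_complex_ofReal]
    simpa using h
  exact_mod_cast h'

namespace Kind

variable (k : Kind)

/-- The transform on integrable square integrable functions. -/
noncomputable def integrableTransform : integrableL2 n →ₗ[ℂ] L2Chamber n where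
  toFun g := (k.memLp_transform g.2 (Lp.memLp (g : L2Chamber n))).toLp
  map_add' f g := by
    rw [← MemLp.toLp_add, MemLp.toLp_eq_toLp_iff]
    have h1 : k.transform (((f + g : integrableL2 n) : L2Chamber n) : (Fin n → ℝ) → ℂ) =
        k.transform ((f : L2Chamber n) + (g : L2Chamber n) : (Fin n → ℝ) → ℂ) :=
      k.transform_congr (Lp.coeFn_add _ _)
    rw [h1, k.transform_add f.2 g.2]
  map_smul' c f := by
    rw [RingHom.id_apply, ← MemLp.toLp_const_smul, MemLp.toLp_eq_toLp_iff]
    have h1 : k.transform (((c • f : integrableL2 n) : L2Chamber n) : (Fin n → ℝ) → ℂ) =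
        k.transform (c • (f : L2Chamber n) : (Fin n → ℝ) → ℂ) :=
      k.transform_congr (Lp.coeFn_smul _ _)
    rw [h1, transform_smul]

theorem integrableTransform_ae_eq (g : integrableL2 n) :
    k.integrableTransform g =ᵐ[volume.restrict (chamber n)] k.transform (g : L2Chamber n) :=
  (k.memLp_transform g.2 (Lp.memLp (g : L2Chamber n))).coeFn_toLp

theorem norm_integrableTransform (g : integrableL2 n) :
    2 ^ n * ‖k.integrableTransform g‖ = ‖(g : L2Chamber n)‖ := by
  have h := k.integral_transform_sq g.2 (Lp.memLp (g : L2Chamber n))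
  have h1 : ∫ x in chamber n, ‖k.transform (g : L2Chamber n) x‖ ^ 2 =
      ∫ x in chamber n, ‖k.integrableTransform g x‖ ^ 2 :=
    integral_congr_ae (by filter_upwards [k.integrableTransform_ae_eq g] with x hx; rw [hx])
  rw [h1, integral_norm_sq_eq_norm_sq, integral_norm_sq_eq_norm_sq, mul_comm 2 n, pow_mul,
    ← mul_pow] at h
  exact ((sq_eq_sq₀ (norm_nonneg _) (by positivity)).1 h).symm

/-- The transform as a bounded operator on `L²` of the chamber. -/
noncomputable def l2Transform : L2Chamber n →L[ℂ] L2Chamber n :=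
  k.integrableTransform.extendOfNorm (integrableL2 n).subtype

theorem l2Transform_coe (g : integrableL2 n) :
    k.l2Transform (g : L2Chamber n) = k.integrableTransform g := by
  -- Any bound serves for the extension; `1` is enough because `1 ≤ 2 ^ n`.
  refine LinearMap.extendOfNorm_eq denseRange_integrableL2 ⟨1, fun f => ?_⟩ g
  rw [one_mul, Submodule.subtype_apply, ← norm_integrableTransform]
  exact le_mul_of_one_le_left (norm_nonneg _) (one_le_pow₀ one_le_two)

theorem norm_l2Transform (g : L2Chamber n) : 2 ^ n * ‖k.l2Transform g‖ = ‖g‖ := by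
  refine denseRange_integrableL2.induction_on
    (p := fun g => 2 ^ n * ‖k.l2Transform g‖ = ‖g‖) g ?_ fun f => ?_
  · exact isClosed_eq (by fun_prop) continuous_norm
  · rw [Submodule.subtype_apply, l2Transform_coe, norm_integrableTransform]

theorem inner_l2Transform_left (f g : L2Chamber n) :
    inner ℂ (k.l2Transform f) g = inner ℂ f (k.l2Transform g) := by
  refine denseRange_integrableL2.induction_on₂
    (p := fun f g => inner ℂ (k.l2Transform f) g = inner ℂ f (k.l2Transform g)) ?_
    (fun f g => ?_) f g
  · exact isClosed_eq (by fun_prop) (by fun_prop)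
  · simp only [Submodule.subtype_apply, l2Transform_coe, L2.inner_def, RCLike.inner_apply]
    refine Eq.trans (integral_congr_ae ?_)
      ((k.integral_mul_conj_transform f.2 g.2).trans (integral_congr_ae ?_))
    · filter_upwards [k.integrableTransform_ae_eq f] with x hx
      rw [hx]
    · filter_upwards [k.integrableTransform_ae_eq g] with x hx
      rw [hx]

/-- With `U = 2 ^ n T` isometric and `T` symmetric, `⟪4 ^ n T T g, h⟫ = ⟪U g, U h⟫ = ⟪g, h⟫` for
every `h`. -/
theorem l2Transform_l2Transform (g : L2Chamber n) :
    (2 ^ (2 * n) : ℂ) • k.l2Transform (k.l2Transform g) = g := by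
  let U : L2Chamber n →ₗᵢ[ℂ] L2Chamber n :=
    { toLinearMap := ((2 ^ n : ℂ) • k.l2Transform : L2Chamber n →L[ℂ] L2Chamber n)
      norm_map' := fun f => by
        simpa [norm_smul] using k.norm_l2Transform f }
  refine ext_inner_right ℂ fun h => ?_
  have h1 : inner ℂ (U g) (U h) = inner ℂ g h := U.inner_map_map g h
  change inner ℂ ((2 ^ n : ℂ) • k.l2Transform g) ((2 ^ n : ℂ) • k.l2Transform h) = _ at h1
  rw [← h1, inner_smul_left, inner_smul_left, inner_smul_right, inner_l2Transform_left]
  simp only [map_pow, Complex.conj_ofNat]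
  ring

end Kind

end MultiTrig

theorem mainTheorem8 (n : ℕ) (k : Kind) :
    -- the transform of an (anti)symmetric function on the orthant
    (∀ f : (Fin n → ℝ) → ℂ, k.HasSymmetry f → IntegrableOn f (chamber n) →
      IntegrableOn f (orthant n) ∧
      ∀ lam : Fin n → ℝ,
        k.transform f lam =
          (Nat.factorial n : ℂ)⁻¹ * ∫ x in orthant n, f x * (k.kernel lam x : ℂ) ∧
        k.transform f lam =
          ∫ x in orthant n, f x * ∏ i, (k.trig (2 * Real.pi * lam i * x i) : ℂ) ∧
        ∀ w : Equiv.Perm (Fin n),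
          k.transform f (fun i => lam (w i)) = k.character w * k.transform f lam) ∧
    -- inversion on the chamber
    (∀ f : (Fin n → ℝ) → ℂ, IntegrableOn f (chamber n) →
      IntegrableOn (k.transform f) (chamber n) →
        (∀ᵐ x ∂volume.restrict (chamber n), f x = k.inverseTransform (k.transform f) x) ∧
        ∀ x ∈ chamber n, ContinuousWithinAt f (chamber n) x →
          f x = k.inverseTransform (k.transform f) x) ∧
    -- inversion on the whole orthant, for an (anti)symmetric function
    (∀ f : (Fin n → ℝ) → ℂ, k.HasSymmetry f → IntegrableOn f (chamber n) →
      IntegrableOn (k.transform f) (chamber n) →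
        (∀ᵐ x ∂volume.restrict (orthant n), f x = k.inverseTransform (k.transform f) x) ∧
        ∀ x ∈ orthant n, ContinuousWithinAt f (orthant n) x →
          f x = k.inverseTransform (k.transform f) x) ∧
    -- the Plancherel formula
    (∀ f : (Fin n → ℝ) → ℂ, IntegrableOn f (chamber n) →
      MemLp f 2 (volume.restrict (chamber n)) →
        MemLp (k.transform f) 2 (volume.restrict (chamber n)) ∧
        ∫ x in chamber n, ‖f x‖ ^ 2 =
          2 ^ (2 * n) * ∫ lam in chamber n, ‖k.transform f lam‖ ^ 2) ∧
    -- transform, inversion and Plancherel formula on all of `L²`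
    (∃ T S : L2Chamber n →L[ℂ] L2Chamber n,
      (∀ g : L2Chamber n, Integrable g (volume.restrict (chamber n)) →
        (T g =ᵐ[volume.restrict (chamber n)] k.transform g) ∧
        (S g =ᵐ[volume.restrict (chamber n)] k.inverseTransform g)) ∧
      (∀ g : L2Chamber n, S (T g) = g ∧ T (S g) = g) ∧
      ∀ g : L2Chamber n,
        ∫ x in chamber n, ‖g x‖ ^ 2 = 2 ^ (2 * n) * ∫ lam in chamber n, ‖T g lam‖ ^ 2) := by

  refine ⟨fun f hs hi => ⟨hs.integrableOn_orthant hi, fun lam =>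
      ⟨hs.transform_eq_integral_kernel hi lam, hs.transform_eq_integral_prod hi lam,
        k.transform_perm f lam⟩⟩,
    fun f hi hi' => ⟨k.ae_eq_inverseTransform hi hi', fun x hx hc =>
      eq_of_ae_eq_of_continuousWithinAt chamber_subset_closure_interior
        (k.ae_eq_inverseTransform hi hi') (k.continuous_inverseTransform hi') hx hc⟩,
    fun f hs hi hi' => ⟨hs.ae_eq_inverseTransform hi hi', fun x hx hc =>
      eq_of_ae_eq_of_continuousWithinAt orthant_subset_closure_interior
        (hs.ae_eq_inverseTransform hi hi') (k.continuous_inverseTransform hi') hx hc⟩,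
    fun f hi h2 => ⟨k.memLp_transform hi h2, k.integral_transform_sq hi h2⟩,
    -- By symmetry of the kernel the inverse is a scalar multiple of the transform, so both
    -- composites are the same identity.
    k.l2Transform, (2 ^ (2 * n) : ℂ) • k.l2Transform, fun g hg => ?_, fun g => ⟨?_, ?_⟩, fun g => ?_⟩
  · have h : k.l2Transform g =ᵐ[volume.restrict (chamber n)] k.transform g := by
      rw [k.l2Transform_coe ⟨g, hg⟩]
      exact k.integrableTransform_ae_eq ⟨g, hg⟩
    refine ⟨h, ?_⟩
    filter_upwards [h, Lp.coeFn_smul (2 ^ (2 * n) : ℂ) (k.l2Transform g)] with x hx hx'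
    rw [smul_apply, hx', Pi.smul_apply, hx, k.inverseTransform_eq, smul_eq_mul]
  · exact k.l2Transform_l2Transform g
  · rw [smul_apply, map_smul]
    exact k.l2Transform_l2Transform g
  · rw [integral_norm_sq_eq_norm_sq, integral_norm_sq_eq_norm_sq, ← k.norm_l2Transform g]
    ring
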